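/- Let $N$ be a lattice of finite rank, $N_{\mathbb R}=N\otimes\mathbb R$, and let $\Sigma$ be a complete simplicial fan of rational strongly convex cones in $N_{\mathbb R}$ that is locally convex: for every ray $\rho$, the union of all cones of $\Sigma$ containing $\rho$ is convex. For a cone $\sigma\in\Sigma$, let $\mathrm{lk}_\Sigma(\sigma)$ be the set of cones $\kappa\in\Sigma$ with $\kappa\cap\sigma=0$ such that $\kappa+\sigma\in\Sigma$, let $|\mathrm{lk}_\Sigma(\sigma)|\subset N_{\mathbb R}$ be the union of these cones, and put $N(\sigma)_{\mathbb R}=N_{\mathbb R}/\mathrm{Span}(\sigma)$. For a ray $\rho$, let $D_\rho$ be the torus-invariant prime divisor of $\rho$ on the toric variety $X_\Sigma$. Statements of the form $-D_\rho|_{D_\rho\cap\cdots}=0$ are understood in the rational divisor class group ($=\mathrm{Pic}\otimes\mathbb Q$) of the indicated intersection of divisors, which is the toric variety of a star in $\Sigma$. For a cone $\tau$ and a ray $\alpha\in\mathrm{lk}_\Sigma(\tau)$, write $(\alpha,\tau)$ for the cone spanned by $\alpha$ and $\tau$. Let $\sigma=\sigma_{j_1,\ldots,j_m}\in\Sigma$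 be the cone spanned by distinct rays $\rho_{j_1},\ldots,\rho_{j_m}$, let $1\le r\le m$, and let $\tau=\sigma_{j_1,\ldots,\widehat{j_r},\ldots,j_m}$ be the face spanned by the rays other than $\rho_{j_r}$. Suppose that $-D_{j_r}|_{D_{j_1}\cap\cdots\cap D_{j_m}}=0$. Then: 1. For every ray $\alpha\in\mathrm{lk}_\Sigma(\tau)$, we have $-D_\alpha|_{D_\alpha\cap D_{j_1}\cap\cdots\cap\widehat{D_{j_r}}\cap\cdots\cap D_{j_m}}=0$ if and only if the image of $|\mathrm{lk}_\Sigma(\alpha,\tau)|$ in $N(\tau)_{\mathbb R}$ is a vector subspace of codimension $1$. 2. A ray $\beta\in\mathrm{lk}_\Sigma(\tau)$ lies in $\mathrm{lk}_\Sigma(\rho_{j_r})$ if and only if it lies in $\mathrm{lk}_\Sigma(\sigma)$. 3. There is at most one ray $\beta\in\mathrm{lk}_\Sigma(\tau)$ with $\beta\neq\rho_{j_r}$, $\beta\notin\mathrm{lk}_\Sigma(\rho_{j_r})$ and $-D_\beta|_{D_\beta\cap D_{j_1}\cap\cdots\cap\widehat{D_{j_r}}\cap\cdots\cap D_{j_m}}=0$.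 4. For such a ray $\beta$, we have $|\mathrm{lk}_\Sigma(\beta,\tau)|=|\mathrm{lk}_\Sigma(\sigma)|$, both in $N_{\mathbb R}$ and after projection to $N(\tau)_{\mathbb R}$, and $\mathrm{lk}_\Sigma(\tau)$ is the suspension of $\mathrm{lk}_\Sigma(\sigma)$ with apexes $\rho_{j_r}$ and $\beta$: its cones are exactly the cones $\kappa$, $\kappa+\rho_{j_r}$ and $\kappa+\beta$ with $\kappa\in\mathrm{lk}_\Sigma(\sigma)$. -/

import Mathlib

open scoped TensorProduct

namespace Toric

section Lattice

variable {L : Type*} [AddCommGroup L]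

/-- A primitive lattice vector: it is not a multiple `k • w` with `k ≥ 0`, `k ≠ 1`
(in particular it is nonzero). -/
def IsPrimitive (v : L) : Prop := ∀ (k : ℕ) (w : L), k • w = v → k = 1

/-- The real vector space `L_ℝ = ℝ ⊗ L`. -/
abbrev RealSpace (L : Type*) [AddCommGroup L] : Type _ := ℝ ⊗[ℤ] L

/-- The inclusion `L → L_ℝ`. -/
def toReal : L →ₗ[ℤ] RealSpace L := TensorProduct.mk ℤ ℝ L 1

/-- The rational dual `M_ℚ = Hom(L, ℚ)`. -/
abbrev RatDual (L : Type*) [AddCommGroup L] : Type _ := L →ₗ[ℤ] ℚ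

/-- The real extension of a rational linear form. -/
noncomputable def RatDual.extend (m : RatDual L) : RealSpace L →ₗ[ℝ] ℝ :=
  TensorProduct.AlgebraTensorModule.lift
    { toFun := fun r => r • ((algebraMap ℚ ℝ).toAddMonoidHom.comp m.toAddMonoidHom).toIntLinearMap
      map_add' := fun r s => add_smul r s _
      map_smul' := fun r s => mul_smul r s _ }

theorem RatDual.extend_toReal (m : RatDual L) (v : L) : m.extend (toReal v) = (m v : ℝ) := by
  change (1 : ℝ) * (m v : ℝ) = m v
  exact one_mul _

/-- Every nonzero vector of a lattice is a positive multiple of a primitive vector. -/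
theorem exists_primitive [Module.Free ℤ L] [Module.Finite ℤ L] (v : L) :
    ∃ p : L × ℕ, v ≠ 0 → IsPrimitive p.1 ∧ 0 < p.2 ∧ p.2 • p.1 = v := by
  by_cases hv : v = 0
  · exact ⟨(0, 0), fun h => absurd hv h⟩
  let b := Module.Free.chooseBasis ℤ L
  obtain ⟨i, hi⟩ : ∃ i, b.repr v i ≠ 0 := by
    by_contra! h
    exact hv (b.repr.map_eq_zero_iff.1 (Finsupp.ext h))
  let P : ℕ → Prop := fun k => ∃ w : L, k • w = v
  have hb : ∀ k, P k → k ≤ (b.repr v i).natAbs := by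
    rintro k ⟨w, rfl⟩
    refine Nat.le_of_dvd (Int.natAbs_pos.2 hi) ?_
    simp [Int.natAbs_mul]
  classical
  have h1 : P 1 := ⟨v, one_smul _ _⟩
  have hP : P (Nat.findGreatest P (b.repr v i).natAbs) :=
    Nat.findGreatest_spec (P := P) (hb 1 h1) h1
  have hmax : ∀ k, P k → k ≤ Nat.findGreatest P (b.repr v i).natAbs :=
    fun k hk => Nat.le_findGreatest (hb k hk) hk
  set c := Nat.findGreatest P (b.repr v i).natAbs
  have hc : 0 < c := hmax 1 h1
  obtain ⟨w, hw⟩ := hP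
  refine ⟨(w, c), fun _ => ⟨?_, hc, hw⟩⟩
  rintro k w' rfl
  have hk : c * k ≤ c := hmax _ ⟨w', by rw [mul_smul]; exact hw⟩
  rcases Nat.lt_trichotomy k 1 with h | h | h
  · obtain rfl : k = 0 := by omega
    simp at hw
    exact absurd hw.symm hv
  · exact h
  · nlinarith

/-- The primitive vector `w` with `v = c • w`, `c > 0`. -/
noncomputable def primitivePart [Module.Free ℤ L] [Module.Finite ℤ L] (v : L) : L :=
  (exists_primitive v).choose.1

/-- The positive integer `c` with `v = c • w`, `w` primitive. -/
noncomputable def multiplicity [Module.Free ℤ L] [Module.Finite ℤ L] (v : L) : ℕ :=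
  (exists_primitive v).choose.2

/-- The linear span, in `L_ℝ`, of a set of lattice vectors. -/
def realSpan (s : Finset L) : Submodule ℝ (RealSpace L) :=
  Submodule.span ℝ (toReal '' (s : Set L))

/-- The sublattice `L ∩ Span(s)`. -/
def spanLattice (s : Finset L) : Submodule ℤ L :=
  ((realSpan s).restrictScalars ℤ).comap toReal

/-- The quotient lattice `L(s) = L / (L ∩ Span(s))`. -/
abbrev QuotLattice (s : Finset L) : Type _ := L ⧸ spanLattice s

/-- The real vector space `L(s)_ℝ = L_ℝ / Span(s)`. -/
abbrev QuotSpace (s : Finset L) : Type _ := RealSpace L ⧸ realSpan s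

theorem smul_mem_spanLattice_iff (s : Finset L) {k : ℤ} (hk : k ≠ 0) (v : L) :
    k • v ∈ spanLattice s ↔ v ∈ spanLattice s := by
  refine ⟨fun h => ?_, fun h => Submodule.smul_mem _ _ h⟩
  have h' : toReal (k • v) ∈ realSpan s := h
  show toReal v ∈ realSpan s
  rw [map_smul, ← Int.cast_smul_eq_zsmul ℝ] at h'
  exact (Submodule.smul_mem_iff _ (Int.cast_ne_zero.2 hk)).1 h'

instance (s : Finset L) : Module.IsTorsionFree ℤ (QuotLattice s) := by
  refine Module.IsTorsionFree.of_smul_eq_zero ?_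
  intro k x h
  obtain ⟨v, rfl⟩ := (spanLattice s).mkQ_surjective x
  by_cases hk : k = 0
  · exact Or.inl hk
  · right
    rw [← map_smul, Submodule.mkQ_apply, Submodule.Quotient.mk_eq_zero,
      smul_mem_spanLattice_iff s hk] at h
    rwa [Submodule.mkQ_apply, Submodule.Quotient.mk_eq_zero]

/-- The cone in `L_ℝ` generated by a finite set of lattice vectors. -/
def cone (s : Finset L) : PointedCone ℝ (RealSpace L) :=
  PointedCone.hull ℝ (toReal '' (s : Set L))

/-- For a simplicial fan in `L_ℝ` with primitive ray generators `u i`, `i ∈ ι`: the map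
`m ↦ div(χ^m) = ∑ i, ⟨m, u i⟩ D_i` from `M_ℚ` to torus-invariant Weil `ℚ`-divisors. -/
def principal {ι : Type*} (u : ι → L) : RatDual L →ₗ[ℤ] (ι → ℚ) :=
  LinearMap.pi fun i => LinearMap.applyₗ (u i)

/-- The rational divisor class group `Cl ⊗ ℚ = A^1 ⊗ ℚ = Pic ⊗ ℚ` of the toric variety of a
simplicial fan in `L_ℝ` with primitive ray generators `u i`, `i ∈ ι`: torus-invariant Weil
`ℚ`-divisors modulo the divisors of (rational multiples of) characters. -/
abbrev DivisorClass {ι : Type*} (u : ι → L) : Type _ := (ι → ℚ) ⧸ LinearMap.range (principal u)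

end Lattice

/-- A simplicial fan of strongly convex rational polyhedral cones in `N_ℝ`. Each cone is recorded
by the set of the primitive generators of its rays; the fan is the set of all `cone s` for
`s ∈ cones`. -/
structure SimplicialFan (N : Type*) [AddCommGroup N] [DecidableEq N] where
  cones : Finset (Finset N)
  empty_mem : ∅ ∈ cones
  face_mem : ∀ s ∈ cones, ∀ t ⊆ s, t ∈ cones
  primitive : ∀ s ∈ cones, ∀ u ∈ s, IsPrimitive u
  linearIndependent : ∀ s ∈ cones, LinearIndependent ℝ (fun u : s => toReal (u : N))
  inter_eq : ∀ s ∈ cones, ∀ t ∈ cones, cone s ⊓ cone t = cone (s ∩ t)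

namespace SimplicialFan

variable {N : Type*} [AddCommGroup N] [DecidableEq N] (Δ : SimplicialFan N)

/-- The fan is complete: its cones cover `N_ℝ`. -/
def IsComplete : Prop := ∀ x : RealSpace N, ∃ s ∈ Δ.cones, x ∈ cone s

/-- The fan is locally convex: for each ray, the union of all cones containing it is convex. -/
def IsLocallyConvex : Prop :=
  ∀ u, {u} ∈ Δ.cones → Convex ℝ (⋃ s ∈ {s ∈ Δ.cones | u ∈ s}, (cone s : Set (RealSpace N)))

/-- The primitive generators of the rays of the fan. -/
def rays : Set N := {u | {u} ∈ Δ.cones}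

/-- The link of the cone `s`: all cones `t` of the fan that share only the origin with `s` and
span a cone of the fan together with `s`. -/
def link (s : Finset N) : Set (Finset N) := {t | Disjoint s t ∧ s ∪ t ∈ Δ.cones}

/-- The (primitive generators of the) rays of the link of `s`. -/
def linkRays (s : Finset N) : Set N := {u | {u} ∈ Δ.link s}

theorem linkRays_subset_rays (s : Finset N) : Δ.linkRays s ⊆ Δ.rays := fun _ hu =>
  Δ.face_mem _ hu.2 _ Finset.subset_union_right

/-- The support of the link of `s` in `N_ℝ`. -/
def linkSupport (s : Finset N) : Set (RealSpace N) := ⋃ t ∈ Δ.link s, (cone t : Set (RealSpace N))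

/-- The realization of the support of the link of `s` in `N(t)_ℝ = N_ℝ / Span(t)`. -/
def linkSupportIn (t s : Finset N) : Set (QuotSpace t) := (realSpan t).mkQ '' Δ.linkSupport s

/-- Torus-invariant Weil `ℚ`-divisors `∑ a_u D_u` of the toric variety `X_Δ`
(all of them are `ℚ`-Cartier since `Δ` is simplicial). -/
abbrev WeilDivisor : Type _ := Δ.rays → ℚ

/-- The prime divisor `D_u` of the ray generated by `u`. -/
def primeDivisor (u : N) : Δ.WeilDivisor := fun v => if (v : N) = u then 1 else 0

/-- A divisor on `X_Δ` is, up to a rational multiple of the divisor of a character, supported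
away from the rays of a given cone. -/
theorem exists_eqOn (D : Δ.WeilDivisor) (s : Finset N) :
    ∃ m : RatDual N, s ∈ Δ.cones → ∀ u : Δ.rays, (u : N) ∈ s → m u = D u := by
  by_cases hs : s ∈ Δ.cones
  swap
  · exact ⟨0, fun h => absurd h hs⟩
  have hray : ∀ u ∈ s, u ∈ Δ.rays := fun u hu =>
    Δ.face_mem s hs {u} (Finset.singleton_subset_iff.2 hu)
  have hR := Δ.linearIndependent s hs
  have hQ : LinearIndependent ℚ (fun u : s => (1 : ℚ) ⊗ₜ[ℤ] (u : N)) := by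
    have h := hR.restrict_scalars (R := ℚ) (fun a b h => by simpa [Algebra.smul_def] using h)
    refine LinearIndependent.of_comp (TensorProduct.AlgebraTensorModule.map
      (Algebra.linearMap ℚ ℝ) (LinearMap.id : N →ₗ[ℤ] N)) ?_
    convert h using 1
    funext u
    change (algebraMap ℚ ℝ 1) ⊗ₜ[ℤ] (u : N) = (1 : ℝ) ⊗ₜ[ℤ] (u : N)
    rw [map_one]
  obtain ⟨f, hf⟩ := LinearMap.exists_extend
    ((Module.Basis.span hQ).constr ℚ (fun u : s => D ⟨u, hray u u.2⟩))
  refine ⟨(f.restrictScalars ℤ).comp (TensorProduct.mk ℤ ℚ N 1), fun _ u hu => ?_⟩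
  have h := congrArg (fun g => g (Module.Basis.span hQ ⟨u, hu⟩)) hf
  rw [Module.Basis.constr_basis] at h
  rw [← h, LinearMap.comp_apply, Submodule.subtype_apply, Module.Basis.span_apply]
  rfl

variable [Module.Finite ℤ N]

/-- The primitive generator, in the quotient lattice `N(s)`, of the ray of the star fan of `s`
that is the image of the ray of the link generated by `u`. -/
noncomputable def starRay (s : Finset N) (u : Δ.linkRays s) : QuotLattice s :=
  primitivePart ((spanLattice s).mkQ (u : N))

/-- The integer `c > 0` such that the image of `u` in `N(s)` is `c` times a primitive vector. -/
noncomputable def starMult (s : Finset N) (u : Δ.linkRays s) : ℕ :=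
  multiplicity ((spanLattice s).mkQ (u : N))

/-- The rational divisor class group of the orbit closure `V(s) = ⋂ u ∈ s, D_u`, that is, of the
toric variety of the star fan of `s` in `N(s)_ℝ`. -/
abbrev OrbitClass (s : Finset N) : Type _ := DivisorClass (Δ.starRay s)

/-- The restriction to `V(s)` of a divisor none of whose components contains `V(s)`:
`D_u` restricts to `(1 / c_u) D_ū` if `u` is a ray of the link of `s`, and to `0` otherwise. -/
noncomputable def restrictProper (s : Finset N) (D : Δ.WeilDivisor) (u : Δ.linkRays s) : ℚ :=
  D ⟨u, Δ.linkRays_subset_rays s u.2⟩ / Δ.starMult s u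

/-- The restriction `D|_{V(s)}` as a rational divisor class on `V(s)`: replace `D` by a linearly
equivalent divisor `D - div(χ^m)` none of whose components contains `V(s)`, and restrict that. -/
noncomputable def restrict (s : Finset N) (D : Δ.WeilDivisor) : Δ.OrbitClass s :=
  Submodule.Quotient.mk <| Δ.restrictProper s <|
    D - principal (fun u : Δ.rays => (u : N)) (Δ.exists_eqOn D s).choose

/-- The restriction does not depend on the choice of `m`. -/
theorem restrict_eq {s : Finset N} (hs : s ∈ Δ.cones) (D : Δ.WeilDivisor) (m : RatDual N)
    (hm : ∀ u : Δ.rays, (u : N) ∈ s → m u = D u) :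
    Δ.restrict s D = Submodule.Quotient.mk
      (Δ.restrictProper s (D - principal (fun u : Δ.rays => (u : N)) m)) := by
  set m' := (Δ.exists_eqOn D s).choose with hm'
  have h' := (Δ.exists_eqOn D s).choose_spec hs
  rw [← hm'] at h'
  have hker : spanLattice s ≤ LinearMap.ker (m - m') := by
    intro v hv
    have hspan : realSpan s ≤ LinearMap.ker (m - m').extend := by
      refine Submodule.span_le.2 ?_
      rintro _ ⟨u, hu, rfl⟩
      have hur : u ∈ Δ.rays := Δ.face_mem s hs {u} (Finset.singleton_subset_iff.2 hu)
      show (m - m').extend (toReal u) = 0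
      rw [RatDual.extend_toReal, LinearMap.sub_apply, hm ⟨u, hur⟩ hu, h' ⟨u, hur⟩ hu, sub_self,
        Rat.cast_zero]
    have h0 : (m - m').extend (toReal v) = 0 := hspan hv
    rw [RatDual.extend_toReal] at h0
    exact_mod_cast h0
  refine (Submodule.Quotient.eq _).2 ⟨(spanLattice s).liftQ (m - m') hker, ?_⟩
  funext u
  have hne : (spanLattice s).mkQ (u : N) ≠ 0 := by
    rw [Submodule.mkQ_apply, Ne, Submodule.Quotient.mk_eq_zero]
    intro hu
    have hli := Δ.linearIndependent _ u.2.2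
    have hnot := hli.notMem_span_image (s := {w | (w : N) ∈ s}) (x := ⟨u, by simp⟩)
      (fun h => Finset.disjoint_left.1 u.2.1 h (Finset.mem_singleton_self _))
    refine hnot (Submodule.span_mono ?_ (show toReal (u : N) ∈ realSpan s from hu))
    rintro _ ⟨w, hw, rfl⟩
    exact ⟨⟨w, Finset.mem_union_left _ hw⟩, hw, rfl⟩
  obtain ⟨-, hpos, hdec⟩ := (exists_primitive ((spanLattice s).mkQ (u : N))).choose_spec hne
  have hc : (Δ.starMult s u : ℚ) ≠ 0 := Nat.cast_ne_zero.2 (Nat.pos_iff_ne_zero.1 hpos)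
  have hdec' : Δ.starMult s u • Δ.starRay s u = (spanLattice s).mkQ (u : N) := hdec
  have key := congrArg ((spanLattice s).liftQ (m - m') hker) hdec'
  rw [map_nsmul, Submodule.mkQ_apply, Submodule.liftQ_apply, nsmul_eq_mul] at key
  show (spanLattice s).liftQ (m - m') hker (Δ.starRay s u) =
    (D _ - m' (u : N)) / (Δ.starMult s u : ℚ) - (D _ - m (u : N)) / (Δ.starMult s u : ℚ)
  rw [← sub_div, eq_div_iff hc, mul_comm, key, LinearMap.sub_apply]
  ring

/-- The conormal bundle restriction `-D_u|_{V(s)}`, where `V(s) = ⋂ v ∈ s, D_v`. -/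
noncomputable def conormal (s : Finset N) (u : N) : Δ.OrbitClass s :=
  - Δ.restrict s (Δ.primeDivisor u)

end SimplicialFan

/-- The subset `S` of `V` is a vector subspace of codimension one. -/
def IsCodimOneSubspace {V : Type*} [AddCommGroup V] [Module ℝ V] (S : Set V) : Prop :=
  ∃ H : Submodule ℝ V, (H : Set V) = S ∧ Module.finrank ℝ (V ⧸ H) = 1

end Toric

/-! The vanishing of the conormal class of `D_α` on `V(α, τ)` means that some real linear form `m`
is `1` on `α` and `0` on `τ` and on the link of `(α, τ)` (`conormal_eq_zero_iff`). Since the star of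
`(α, τ)` is complete, every `x` is, modulo `Span τ`, a point of that link plus `m x • α`. Hence the
link projects onto the hyperplane `m = 0`, which gives the codimension criterion.

Let `m`, `m'` be such forms for `ρ`, `β`. At a point where both are positive, the two decompositions
coincide, because the support of the link of `τ` embeds in `N(τ)_ℝ` (`eq_of_sub_mem_realSpan`); this
makes `ρ` and `β` adjacent. If they are not adjacent, `m'` is therefore a negative multiple of `m`
(`exists_eq_smul`). The kernels agree, so the links of `(ρ, τ)` and `(β, τ)` agree, and the sign of
`m` splits the link of `τ` into two halves with apexes `ρ` and `β`. Two different such `β` would lie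
on the same side and be adjacent, which is absurd.

Local convexity gives the flag property, hence the adjacency statement. -/

namespace Toric

/-! ### Coordinates on cones and spans -/

section Cones

variable {L : Type*} [AddCommGroup L]

theorem mem_realSpan_iff {s : Finset L} {x : RealSpace L} :
    x ∈ realSpan s ↔ ∃ c : L → ℝ, ∑ u ∈ s, c u • toReal u = x := by
  rw [realSpan, Submodule.mem_span_image_finset_iff_exists_fun]
  constructor
  · rintro ⟨c, rfl⟩
    classical
    refine ⟨fun u => if h : u ∈ s then c ⟨u, h⟩ else 0, ?_⟩
    rw [← Finset.sum_coe_sort]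
    exact Finset.sum_congr rfl fun u _ => by simp
  · rintro ⟨c, rfl⟩
    exact ⟨fun u => c u, Finset.sum_coe_sort s fun u => c u • toReal u⟩

theorem mem_cone_iff {s : Finset L} {x : RealSpace L} :
    x ∈ cone s ↔ ∃ c : L → ℝ, (∀ u ∈ s, 0 ≤ c u) ∧ ∑ u ∈ s, c u • toReal u = x := by
  rw [cone, PointedCone.hull, Submodule.mem_span_image_finset_iff_exists_fun]
  constructor
  · rintro ⟨c, rfl⟩
    classical
    refine ⟨fun u => if h : u ∈ s then (c ⟨u, h⟩ : ℝ) else 0, fun u hu => ?_, ?_⟩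
    · simp only [hu, dif_pos]
      exact (c ⟨u, hu⟩).2
    · rw [← Finset.sum_coe_sort]
      refine Finset.sum_congr rfl fun u _ => ?_
      simp only [u.2, dif_pos]
      rfl
  · rintro ⟨c, hc, rfl⟩
    exact ⟨fun u => ⟨c u, hc u u.2⟩, Finset.sum_coe_sort s fun u => c u • toReal u⟩

theorem cone_mono {s t : Finset L} (h : s ⊆ t) : cone s ≤ cone t :=
  Submodule.span_mono (Set.image_mono (Finset.coe_subset.2 h))

theorem toReal_mem_cone {s : Finset L} {u : L} (hu : u ∈ s) : toReal u ∈ cone s :=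
  Submodule.subset_span ⟨u, hu, rfl⟩

theorem toReal_mem_realSpan {s : Finset L} {u : L} (hu : u ∈ s) : toReal u ∈ realSpan s :=
  Submodule.subset_span ⟨u, hu, rfl⟩

theorem mem_realSpan_of_mem_cone {s : Finset L} {x : RealSpace L} (hx : x ∈ cone s) :
    x ∈ realSpan s := by
  obtain ⟨c, -, hc⟩ := mem_cone_iff.1 hx
  exact mem_realSpan_iff.2 ⟨c, hc⟩

theorem sum_mem_cone (s : Finset L) : ∑ u ∈ s, toReal u ∈ cone s :=
  Submodule.sum_mem _ fun _ hu => toReal_mem_cone hu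

theorem smul_mem_cone {s : Finset L} {x : RealSpace L} (hx : x ∈ cone s) {r : ℝ} (hr : 0 ≤ r) :
    r • x ∈ cone s :=
  (cone s).smul_mem hr hx

theorem cone_union [DecidableEq L] (s t : Finset L) : cone (s ∪ t) = cone s ⊔ cone t := by
  rw [cone, cone, cone, Finset.coe_union, Set.image_union]
  exact Submodule.span_union _ _

theorem exists_sub_of_mem_realSpan {s : Finset L} {x : RealSpace L} (hx : x ∈ realSpan s) :
    ∃ a ∈ cone s, ∃ b ∈ cone s, a - b = x := by
  obtain ⟨c, rfl⟩ := mem_realSpan_iff.1 hx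
  refine ⟨_, mem_cone_iff.2 ⟨fun u => max (c u) 0, fun _ _ => le_max_right _ _, rfl⟩,
    _, mem_cone_iff.2 ⟨fun u => max (-c u) 0, fun _ _ => le_max_right _ _, rfl⟩, ?_⟩
  rw [← Finset.sum_sub_distrib]
  refine Finset.sum_congr rfl fun u _ => ?_
  rw [← sub_smul]
  congr 1
  rcases le_total 0 (c u) with h | h
  · simp [h]
  · simp [h]

theorem map_eq_zero_of_mem_realSpan {s : Finset L} {m : RealSpace L →ₗ[ℝ] ℝ}
    (hm : ∀ u ∈ s, m (toReal u) = 0) {x : RealSpace L} (hx : x ∈ realSpan s) : m x = 0 := by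
  obtain ⟨c, rfl⟩ := mem_realSpan_iff.1 hx
  rw [map_sum]
  exact Finset.sum_eq_zero fun u hu => by rw [map_smul, hm u hu, smul_zero]

end Cones

/-! ### Links, completeness of stars, and flagness -/

namespace SimplicialFan

variable {N : Type*} [AddCommGroup N] [DecidableEq N] {Δ : SimplicialFan N}

theorem eq_of_sum_eq {s : Finset N} (hs : s ∈ Δ.cones) {c d : N → ℝ}
    (h : ∑ u ∈ s, c u • toReal u = ∑ u ∈ s, d u • toReal u) : ∀ u ∈ s, c u = d u := by
  have hl : LinearIndepOn ℝ (fun u : N => toReal u) (s : Set N) := Δ.linearIndependent s hs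
  rw [linearIndepOn_finset_iff] at hl
  intro u hu
  refine sub_eq_zero.1 (hl (fun u => c u - d u) ?_ u hu)
  simp only [sub_smul, Finset.sum_sub_distrib, h, sub_self]

/-- A cone of the fan that contains a relatively interior point of `cone s` has `cone s` as a
face. -/
theorem subset_of_sum_mem_cone {s t : Finset N} (hs : s ∈ Δ.cones) (ht : t ∈ Δ.cones)
    (h : ∑ u ∈ s, toReal u ∈ cone t) : s ⊆ t := by
  have h' : ∑ u ∈ s, toReal u ∈ cone (s ∩ t) := by
    rw [← Δ.inter_eq s hs t ht]
    exact ⟨sum_mem_cone s, h⟩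
  obtain ⟨c, -, hc⟩ := mem_cone_iff.1 h'
  intro u hu
  by_contra hut
  -- At a generator outside `t`, uniqueness of coordinates on `s` would give `1 = 0`.
  have key := eq_of_sum_eq (Δ := Δ) hs (c := fun _ => 1) (d := fun u => if u ∈ t then c u else 0)
    (by
      simp only [one_smul, ite_smul, zero_smul, ← Finset.sum_filter]
      rw [Finset.filter_mem_eq_inter, hc]) u hu
  simp [hut] at key

theorem disjoint_realSpan {s t : Finset N} (h : t ∈ Δ.link s) :
    Disjoint (realSpan s) (realSpan t) := by
  have hl : LinearIndepOn ℝ (fun u : N => toReal u) ((s ∪ t : Finset N) : Set N) :=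
    Δ.linearIndependent _ h.2
  have h' := LinearIndependent.disjoint_span_image hl
    (s := {u | (u : N) ∈ s}) (t := {u | (u : N) ∈ t})
    (Set.disjoint_left.2 fun u hu hu' => Finset.disjoint_left.1 h.1 hu hu')
  refine h'.mono (Submodule.span_mono ?_) (Submodule.span_mono ?_)
  · rintro _ ⟨u, hu, rfl⟩
    exact ⟨⟨u, Finset.mem_union_left _ hu⟩, hu, rfl⟩
  · rintro _ ⟨u, hu, rfl⟩
    exact ⟨⟨u, Finset.mem_union_right _ hu⟩, hu, rfl⟩

theorem mem_cones_of_mem_link {s t : Finset N} (h : t ∈ Δ.link s) : t ∈ Δ.cones :=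
  Δ.face_mem _ h.2 _ Finset.subset_union_right

theorem link_mono {s t t' : Finset N} (h : t ∈ Δ.link s) (ht : t' ⊆ t) : t' ∈ Δ.link s :=
  ⟨h.1.mono_right ht, Δ.face_mem _ h.2 _ (Finset.union_subset_union_right ht)⟩

theorem mem_linkRays_of_mem_link {s t : Finset N} (h : t ∈ Δ.link s) {u : N} (hu : u ∈ t) :
    u ∈ Δ.linkRays s :=
  link_mono h (Finset.singleton_subset_iff.2 hu)

theorem insert_mem_link {s t : Finset N} {u : N} (hu : u ∈ Δ.linkRays s)
    (ht : t ∈ Δ.link (insert u s)) : insert u t ∈ Δ.link s := by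
  refine ⟨?_, ?_⟩
  · rw [Finset.disjoint_insert_right]
    exact ⟨fun h => Finset.disjoint_left.1 hu.1 h (Finset.mem_singleton_self u),
      ht.1.mono_left (Finset.subset_insert _ _)⟩
  · rw [Finset.union_insert, ← Finset.insert_union]
    exact ht.2

theorem insert_mem_cones {s : Finset N} {u : N} (hu : u ∈ Δ.linkRays s) :
    insert u s ∈ Δ.cones := by
  have h := hu.2
  rwa [Finset.union_comm, ← Finset.insert_eq] at h

theorem notMem_of_mem_linkRays {s : Finset N} {u : N} (hu : u ∈ Δ.linkRays s) : u ∉ s :=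
  fun h => Finset.disjoint_left.1 hu.1 h (Finset.mem_singleton_self u)

theorem mem_link_of_mem_link_insert {s t : Finset N} {u : N}
    (ht : t ∈ Δ.link (insert u s)) : t ∈ Δ.link s :=
  ⟨ht.1.mono_left (Finset.subset_insert _ _),
    Δ.face_mem _ ht.2 _ (Finset.union_subset_union_left (Finset.subset_insert _ _))⟩

/-- The support of the link of `s` projects injectively to `N(s)_ℝ`. -/
theorem eq_of_sub_mem_realSpan {s t t' : Finset N} (ht : t ∈ Δ.link s) (ht' : t' ∈ Δ.link s)
    {y y' : RealSpace N} (hy : y ∈ cone t) (hy' : y' ∈ cone t') (h : y - y' ∈ realSpan s) :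
    y = y' := by
  obtain ⟨a, ha, b, hb, hab⟩ := exists_sub_of_mem_realSpan h
  have hz : b + y = a + y' := by
    rw [sub_eq_sub_iff_add_eq_add] at hab
    rw [hab, add_comm]
  -- The common point `b + y = a + y'` lies in the cones of `s ∪ t` and `s ∪ t'`, hence in that of
  -- their intersection. Its component `w` along `t ∩ t'` must be both `y` and `y'`, by independence
  -- from `s`.
  have h1 : b + y ∈ cone (s ∪ (t ∩ t')) := by
    rw [Finset.union_inter_distrib_left, ← Δ.inter_eq _ ht.2 _ ht'.2, cone_union, cone_union]
    refine ⟨Submodule.add_mem_sup hb hy, ?_⟩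
    rw [hz]
    exact Submodule.add_mem_sup ha hy'
  rw [cone_union] at h1
  obtain ⟨q, hq, w, hw, hqw⟩ := Submodule.mem_sup.1 h1
  have key : ∀ {t : Finset N} {a y : RealSpace N}, t ∈ Δ.link s → a ∈ cone s → y ∈ cone t →
      w ∈ cone t → q + w = a + y → y = w := by
    intro t a y ht ha hy hw h
    have e : q - a = y - w := sub_eq_sub_iff_add_eq_add.2 (by rw [h, add_comm])
    have h0 := Submodule.disjoint_def.1 (disjoint_realSpan ht) (q - a)
      (Submodule.sub_mem _ (mem_realSpan_of_mem_cone hq) (mem_realSpan_of_mem_cone ha))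
      (e ▸ Submodule.sub_mem _ (mem_realSpan_of_mem_cone hy) (mem_realSpan_of_mem_cone hw))
    exact sub_eq_zero.1 (e ▸ h0)
  rw [key ht hb hy (cone_mono Finset.inter_subset_left hw) hqw,
    key ht' ha hy' (cone_mono Finset.inter_subset_right hw) (hqw.trans hz)]

/-- In a complete fan, the star of every cone is complete. -/
theorem IsComplete.exists_mem_link (hΔ : Δ.IsComplete) {s : Finset N} (hs : s ∈ Δ.cones)
    (x : RealSpace N) : ∃ t ∈ Δ.link s, ∃ y ∈ cone t, x - y ∈ realSpan s := by
  set p : RealSpace N := ∑ u ∈ s, toReal u with hp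
  have hps : p ∈ realSpan s := mem_realSpan_of_mem_cone (sum_mem_cone s)
  -- Push `x` far in the direction of the interior point `p` of `cone s`. There are finitely many
  -- cones, so one cone `t` contains `n • p + x` for infinitely many `n`.
  have hcov : ∀ n : ℕ, ∃ t : Δ.cones, (n : ℝ) • p + x ∈ cone t.1 := fun n => by
    obtain ⟨t, ht, h⟩ := hΔ ((n : ℝ) • p + x)
    exact ⟨⟨t, ht⟩, h⟩
  choose f hf using hcov
  obtain ⟨⟨t, ht⟩, hinf⟩ := Finite.exists_infinite_fiber f
  have hinf' := Set.infinite_coe_iff.1 hinf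
  have hmem : ∀ n ∈ f ⁻¹' {⟨t, ht⟩}, (n : ℝ) • p + x ∈ cone t := by
    intro n hn
    have h := hf n
    rwa [show f n = ⟨t, ht⟩ from hn] at h
  obtain ⟨n₁, hn₁⟩ := hinf'.nonempty
  obtain ⟨n₂, hn₂, hlt⟩ := hinf'.exists_gt n₁
  have hpt : p ∈ realSpan t := by
    have h := Submodule.sub_mem _ (mem_realSpan_of_mem_cone (hmem n₂ hn₂))
      (mem_realSpan_of_mem_cone (hmem n₁ hn₁))
    rw [add_sub_add_right_eq_sub, ← sub_smul] at h
    exact (Submodule.smul_mem_iff _ (sub_ne_zero.2 (by exact_mod_cast hlt.ne'))).1 h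
  have hxt : x ∈ realSpan t := by
    have h := Submodule.sub_mem _ (mem_realSpan_of_mem_cone (hmem n₁ hn₁))
      (Submodule.smul_mem _ (n₁ : ℝ) hpt)
    rwa [add_sub_cancel_left] at h
  obtain ⟨d, hd⟩ := mem_realSpan_iff.1 hpt
  obtain ⟨e, he⟩ := mem_realSpan_iff.1 hxt
  have hp' : p ∈ cone t := by
    refine mem_cone_iff.2 ⟨d, fun u hu => ?_, hd⟩
    by_contra! hneg
    -- Beyond this bound the coordinate `n * d u + e u` of `n • p + x` would be negative.
    obtain ⟨k, hk⟩ := exists_nat_gt (e u / (-d u))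
    obtain ⟨n, hn, hkn⟩ := hinf'.exists_gt k
    obtain ⟨c, hc, hsum⟩ := mem_cone_iff.1 (hmem n hn)
    have heq := eq_of_sum_eq (Δ := Δ) ht (c := c) (d := fun u => n * d u + e u) (by
      rw [hsum]
      simp only [add_smul, Finset.sum_add_distrib, mul_smul, ← Finset.smul_sum, hd, he]) u hu
    have h0 := hc u hu
    rw [div_lt_iff₀ (by linarith)] at hk
    have hkn' : (k : ℝ) < n := by exact_mod_cast hkn
    nlinarith
  have hst : s ⊆ t := subset_of_sum_mem_cone hs ht hp'
  obtain ⟨c, hc, hsum⟩ := mem_cone_iff.1 (hmem n₁ hn₁)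
  refine ⟨t \ s, ⟨Finset.disjoint_sdiff, by rwa [Finset.union_sdiff_of_subset hst]⟩,
    ∑ u ∈ t \ s, c u • toReal u,
    mem_cone_iff.2 ⟨c, fun u hu => hc u (Finset.sdiff_subset hu), rfl⟩, ?_⟩
  have hx : x - ∑ u ∈ t \ s, c u • toReal u = ∑ u ∈ s, c u • toReal u - (n₁ : ℝ) • p := by
    rw [sub_eq_sub_iff_add_eq_add, add_comm x, ← hsum, add_comm (∑ u ∈ s, _)]
    exact (Finset.sum_sdiff hst).symm
  rw [hx]
  exact Submodule.sub_mem _ (mem_realSpan_iff.2 ⟨c, rfl⟩) (Submodule.smul_mem _ _ hps)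

/-- A locally convex fan is a flag complex. -/
theorem IsLocallyConvex.insert_mem_cones (hΔ : Δ.IsLocallyConvex) {v : N} {s : Finset N}
    (hv : {v} ∈ Δ.cones) (hs : s ∈ Δ.cones) (h : ∀ u ∈ s, {v, u} ∈ Δ.cones) :
    insert v s ∈ Δ.cones := by
  have hmem : ∀ x : RealSpace N, x ∈ (⋃ s ∈ {s ∈ Δ.cones | v ∈ s}, (cone s : Set (RealSpace N))) ↔
      ∃ t ∈ Δ.cones, v ∈ t ∧ x ∈ cone t := by
    intro x
    simp [and_assoc]
  -- The star of `v` is closed under addition: it contains midpoints by convexity, and doubling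
  -- stays in the cone. So an interior point of `cone s` lies in a cone containing `v`.
  have hsum : ∑ u ∈ s, toReal u ∈ ⋃ s ∈ {s ∈ Δ.cones | v ∈ s}, (cone s : Set (RealSpace N)) := by
    refine Finset.sum_induction _ (· ∈ ⋃ s ∈ {s ∈ Δ.cones | v ∈ s}, (cone s : Set (RealSpace N)))
      (fun x y hx hy => ?_) ?_ fun u hu => ?_
    · have hxy := (hΔ v hv) hx hy (a := 1 / 2) (b := 1 / 2) (by norm_num) (by norm_num)
        (by norm_num)
      obtain ⟨t, ht, hvt, hz⟩ := (hmem _).1 hxy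
      refine (hmem _).2 ⟨t, ht, hvt, ?_⟩
      have h2 := smul_mem_cone hz (r := 2) (by norm_num)
      rw [← smul_add, smul_smul] at h2
      norm_num at h2
      exact h2
    · exact (hmem _).2 ⟨{v}, hv, Finset.mem_singleton_self v, Submodule.zero_mem _⟩
    · exact (hmem _).2 ⟨{v, u}, h u hu, by simp, toReal_mem_cone (by simp)⟩
  obtain ⟨t, ht, hvt, hz⟩ := (hmem _).1 hsum
  exact Δ.face_mem t ht _ (Finset.insert_subset hvt (subset_of_sum_mem_cone hs ht hz))

end SimplicialFan

end Toric

namespace Toric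

/-! ### Conormal classes as linear forms -/

namespace SimplicialFan

variable {N : Type*} [AddCommGroup N] [DecidableEq N] {Δ : SimplicialFan N}

/-- A real linear form that equals `1` on the ray generator `α` and vanishes on the cone `τ` and on
the link of the cone spanned by `α` and `τ`. -/
structure IsConormalForm (Δ : SimplicialFan N) (τ : Finset N) (α : N)
    (m : RealSpace N →ₗ[ℝ] ℝ) : Prop where
  apply_self : m (toReal α) = 1
  apply_mem : ∀ v ∈ τ, m (toReal v) = 0
  apply_linkRays : ∀ w ∈ Δ.linkRays (insert α τ), m (toReal w) = 0

theorem mkQ_ne_zero {s : Finset N} {u : N} (hu : u ∈ Δ.linkRays s) :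
    (spanLattice s).mkQ u ≠ 0 := by
  rw [Submodule.mkQ_apply, Ne, Submodule.Quotient.mk_eq_zero]
  intro h
  have h0 := Submodule.disjoint_def.1 (disjoint_realSpan hu) (toReal u) h
    (toReal_mem_realSpan (Finset.mem_singleton_self u))
  have hl := (Δ.linearIndependent _ (mem_cones_of_mem_link hu)).ne_zero
    ⟨u, Finset.mem_singleton_self u⟩
  exact hl h0

/-- The conormal class of `D_α` on `V(α, τ)` vanishes iff there is a linear form as in
`IsConormalForm`. -/
theorem conormal_eq_zero_iff [Module.Free ℤ N] [Module.Finite ℤ N] {τ : Finset N} {α : N}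
    (hα : α ∈ Δ.linkRays τ) :
    Δ.conormal (insert α τ) α = 0 ↔ ∃ m, Δ.IsConormalForm τ α m := by
  have hs := insert_mem_cones hα
  have hατ := notMem_of_mem_linkRays hα
  have hray : ∀ u ∈ insert α τ, u ∈ Δ.rays := fun u hu =>
    Δ.face_mem _ hs {u} (Finset.singleton_subset_iff.2 hu)
  have hlink : ∀ w ∈ Δ.linkRays (insert α τ), w ≠ α := fun w hw h =>
    notMem_of_mem_linkRays hw (h ▸ Finset.mem_insert_self _ _)
  rw [conormal, neg_eq_zero]
  constructor
  · intro h
    obtain ⟨m₀, hm₀⟩ := Δ.exists_eqOn (Δ.primeDivisor α) (insert α τ)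
    rw [Δ.restrict_eq hs _ m₀ (hm₀ hs), Submodule.Quotient.mk_eq_zero] at h
    obtain ⟨g, hg⟩ := h
    have hzero : ∀ u ∈ insert α τ, g ((spanLattice (insert α τ)).mkQ u) = 0 := by
      intro u hu
      rw [Submodule.mkQ_apply, (Submodule.Quotient.mk_eq_zero _).2
        (show u ∈ spanLattice (insert α τ) from toReal_mem_realSpan hu), map_zero]
    -- `m₀` moves `D_α` off `V(α, τ)`, and the restricted divisor is that of the character `g` of
    -- the quotient lattice. Adding `g` cancels the values of `m₀` on the link and changes nothing
    -- on `α` and `τ`.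
    refine ⟨(m₀ + g.comp (spanLattice (insert α τ)).mkQ).extend, ?_, ?_, ?_⟩
    · rw [RatDual.extend_toReal, LinearMap.add_apply, LinearMap.comp_apply,
        hzero α (Finset.mem_insert_self _ _),
        hm₀ hs ⟨α, hray α (Finset.mem_insert_self _ _)⟩ (Finset.mem_insert_self _ _)]
      simp [primeDivisor]
    · intro v hv
      have hv' := Finset.mem_insert_of_mem (b := α) hv
      rw [RatDual.extend_toReal, LinearMap.add_apply, LinearMap.comp_apply,
        hzero v hv', hm₀ hs ⟨v, hray v hv'⟩ hv']
      have : v ≠ α := fun h => hατ (h ▸ hv)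
      simp [primeDivisor, this]
    · intro w hw
      obtain ⟨-, hpos, hdec⟩ := (exists_primitive
        ((spanLattice (insert α τ)).mkQ w)).choose_spec (mkQ_ne_zero hw)
      have hc : (Δ.starMult (insert α τ) ⟨w, hw⟩ : ℚ) ≠ 0 :=
        Nat.cast_ne_zero.2 (Nat.pos_iff_ne_zero.1 hpos)
      have hdec' : Δ.starMult (insert α τ) ⟨w, hw⟩ • Δ.starRay (insert α τ) ⟨w, hw⟩ =
        (spanLattice (insert α τ)).mkQ w := hdec
      have hgw : g (Δ.starRay (insert α τ) ⟨w, hw⟩) =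
          ((if w = α then 1 else 0) - m₀ w) / Δ.starMult (insert α τ) ⟨w, hw⟩ :=
        congrFun hg ⟨w, hw⟩
      rw [if_neg (hlink w hw), eq_div_iff hc] at hgw
      rw [RatDual.extend_toReal, LinearMap.add_apply, LinearMap.comp_apply, ← hdec', map_nsmul,
        nsmul_eq_mul, mul_comm, hgw]
      simp
  · rintro ⟨m, h1, h2, h3⟩
    -- The form `m` may take irrational values on `N`. A `ℚ`-linear retraction `ℝ → ℚ` makes it
    -- rational and keeps the prescribed values `0` and `1`.
    obtain ⟨φ, hφ⟩ := LinearMap.exists_leftInverse_of_injective (Algebra.linearMap ℚ ℝ)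
      (LinearMap.ker_eq_bot.2 (algebraMap ℚ ℝ).injective)
    have hφ1 : φ 1 = 1 := by
      have := LinearMap.congr_fun hφ 1
      simpa using this
    let f : RatDual N :=
      (φ.restrictScalars ℤ).comp ((m.restrictScalars ℤ).comp toReal)
    have hf : ∀ u, f u = φ (m (toReal u)) := fun u => rfl
    rw [Δ.restrict_eq hs _ f]
    · rw [Submodule.Quotient.mk_eq_zero]
      convert Submodule.zero_mem _ using 1
      funext w
      change ((if (w : N) = α then 1 else 0) - f w) / (Δ.starMult (insert α τ) w : ℚ) = 0
      rw [if_neg (hlink w w.2), hf, h3 w w.2, map_zero, sub_zero, zero_div]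
    · intro u hu
      rw [hf]
      rcases Finset.mem_insert.1 hu with h | h
      · rw [h, h1, hφ1]
        simp [primeDivisor, h]
      · rw [h2 u h, map_zero]
        have : (u : N) ≠ α := fun h' => hατ (h' ▸ h)
        simp [primeDivisor, this]

namespace IsConormalForm

variable {τ : Finset N} {α : N} {m : RealSpace N →ₗ[ℝ] ℝ}

theorem apply_realSpan (h : Δ.IsConormalForm τ α m) {x : RealSpace N} (hx : x ∈ realSpan τ) :
    m x = 0 :=
  map_eq_zero_of_mem_realSpan h.apply_mem hx

theorem apply_cone (h : Δ.IsConormalForm τ α m) {t : Finset N} (ht : t ∈ Δ.link (insert α τ))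
    {x : RealSpace N} (hx : x ∈ cone t) : m x = 0 :=
  map_eq_zero_of_mem_realSpan
    (fun _ hu => h.apply_linkRays _ (mem_linkRays_of_mem_link ht hu)) (mem_realSpan_of_mem_cone hx)

/-- Modulo the span of `τ`, every vector is the sum of a vector in the support of the link of
`(α, τ)` and a multiple of `α`. -/
theorem exists_mem_link (h : Δ.IsConormalForm τ α m) (hΔ : Δ.IsComplete) (hα : α ∈ Δ.linkRays τ)
    (x : RealSpace N) :
    ∃ t ∈ Δ.link (insert α τ), ∃ y ∈ cone t, x - (y + m x • toReal α) ∈ realSpan τ := by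
  obtain ⟨t, ht, y, hy, hxy⟩ := hΔ.exists_mem_link (insert_mem_cones hα) x
  refine ⟨t, ht, y, hy, ?_⟩
  rw [realSpan, Finset.coe_insert, Set.image_insert_eq, Submodule.mem_span_insert] at hxy
  obtain ⟨c, z, hz, hc⟩ := hxy
  have hm : m x = c := by
    have := congrArg m hc
    rwa [map_sub, h.apply_cone ht hy, map_add, map_smul, h.apply_self, h.apply_realSpan hz,
      sub_zero, add_zero, smul_eq_mul, mul_one] at this
  rw [hm, ← sub_sub, hc, add_sub_cancel_left]
  exact hz

/-- The form vanishes on the link; conversely, on its kernel the `α`-term of the decomposition in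
`exists_mem_link` disappears. -/
theorem linkSupportIn_eq (h : Δ.IsConormalForm τ α m) (hΔ : Δ.IsComplete)
    (hα : α ∈ Δ.linkRays τ) :
    Δ.linkSupportIn τ (insert α τ) = (realSpan τ).mkQ '' (LinearMap.ker m : Set _) := by
  ext x
  constructor
  · rintro ⟨y, hy, rfl⟩
    simp only [linkSupport, Set.mem_iUnion] at hy
    obtain ⟨t, ht, hy⟩ := hy
    exact ⟨y, h.apply_cone ht hy, rfl⟩
  · rintro ⟨y, hy, rfl⟩
    obtain ⟨t, ht, z, hz, hyz⟩ := h.exists_mem_link hΔ hα y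
    rw [LinearMap.mem_ker.1 hy, zero_smul, add_zero] at hyz
    exact ⟨z, Set.mem_biUnion ht hz, ((Submodule.Quotient.eq _).2 hyz).symm⟩

/-- If two conormal forms are positive at the same point, then the two rays are adjacent. -/
theorem mem_linkRays_of_pos {β : N} {m' : RealSpace N →ₗ[ℝ] ℝ} (h : Δ.IsConormalForm τ α m)
    (h' : Δ.IsConormalForm τ β m') (hΔ : Δ.IsComplete) (hα : α ∈ Δ.linkRays τ)
    (hβ : β ∈ Δ.linkRays τ) (hne : α ≠ β) {x : RealSpace N} (hx : 0 < m x) (hx' : 0 < m' x) :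
    α ∈ Δ.linkRays (insert β τ) := by
  obtain ⟨t, ht, y, hy, hxy⟩ := h.exists_mem_link hΔ hα x
  obtain ⟨t', ht', y', hy', hxy'⟩ := h'.exists_mem_link hΔ hβ x
  have hz : y + m x • toReal α ∈ cone (insert α t) :=
    Submodule.add_mem _ (cone_mono (Finset.subset_insert _ _) hy)
      (smul_mem_cone (toReal_mem_cone (Finset.mem_insert_self _ _)) hx.le)
  have hz' : y' + m' x • toReal β ∈ cone (insert β t') :=
    Submodule.add_mem _ (cone_mono (Finset.subset_insert _ _) hy')
      (smul_mem_cone (toReal_mem_cone (Finset.mem_insert_self _ _)) hx'.le)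
  have hl := insert_mem_link hα ht
  have hl' := insert_mem_link hβ ht'
  have heq := eq_of_sub_mem_realSpan hl hl' hz hz' (by
    have := Submodule.sub_mem _ hxy' hxy
    rwa [sub_sub_sub_cancel_left] at this)
  have hmem : y + m x • toReal α ∈ cone (insert α t ∩ insert β t') := by
    rw [← Δ.inter_eq _ (mem_cones_of_mem_link hl) _ (mem_cones_of_mem_link hl')]
    exact ⟨hz, heq ▸ hz'⟩
  -- Otherwise the common point would lie in `cone t`, where `m` vanishes, although its value there
  -- is `m x > 0`.
  have hαt' : α ∈ insert β t' := by
    by_contra hn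
    have hsub : insert α t ∩ insert β t' ⊆ t := by
      intro u hu
      obtain ⟨h1, h2⟩ := Finset.mem_inter.1 hu
      exact (Finset.mem_insert.1 h1).resolve_left fun e => hn (e ▸ h2)
    have h0 := h.apply_cone ht (cone_mono hsub hmem)
    rw [map_add, map_smul, h.apply_self, h.apply_cone ht hy] at h0
    simp [hx.ne'] at h0
  exact mem_linkRays_of_mem_link ht' ((Finset.mem_insert.1 hαt').resolve_left hne)

/-- The conormal forms of two nonadjacent rays are negative multiples of each other. -/
theorem exists_eq_smul {β : N} {m' : RealSpace N →ₗ[ℝ] ℝ} (h : Δ.IsConormalForm τ α m)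
    (h' : Δ.IsConormalForm τ β m') (hΔ : Δ.IsComplete) (hα : α ∈ Δ.linkRays τ)
    (hβ : β ∈ Δ.linkRays τ) (hne : α ≠ β) (hadj : α ∉ Δ.linkRays (insert β τ)) :
    ∃ c : ℝ, c < 0 ∧ ∀ x, m' x = c * m x := by
  have hpos : ∀ x, 0 < m x → m' x ≤ 0 := fun x hx => not_lt.1 fun hx' =>
    hadj (h.mem_linkRays_of_pos h' hΔ hα hβ hne hx hx')
  have hker : ∀ x, m x = 0 → m' x ≤ 0 := by
    intro x hx
    by_contra! hx'
    -- The coefficient is chosen so that `m` and `m'` both take the value `1` at this point.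
    have h1 := hpos (toReal α + ((1 - m' (toReal α)) / m' x) • x) (by
      rw [map_add, map_smul, hx, h.apply_self]
      simp)
    rw [map_add, map_smul, smul_eq_mul, div_mul_cancel₀ _ hx'.ne'] at h1
    linarith
  have heq : ∀ x, m' x = m' (toReal α) * m x := by
    intro x
    have h0 : m (x - m x • toReal α) = 0 := by
      rw [map_sub, map_smul, h.apply_self, smul_eq_mul, mul_one, sub_self]
    have h1 := hker _ h0
    -- The kernel of `m` is symmetric, so `m' ≤ 0` on it forces `m' = 0`.
    have h2 := hker (-(x - m x • toReal α)) (by rw [map_neg, h0, neg_zero])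
    rw [map_neg] at h2
    have h3 : m' (x - m x • toReal α) = 0 := le_antisymm h1 (by linarith)
    rw [map_sub, map_smul, smul_eq_mul, sub_eq_zero] at h3
    rw [h3, mul_comm]
  refine ⟨m' (toReal α), lt_of_le_of_ne (hpos _ ?_) fun h0 => ?_, heq⟩
  · rw [h.apply_self]
    exact one_pos
  · have := heq (toReal β)
    rw [h'.apply_self, h0, zero_mul] at this
    exact one_ne_zero this

end IsConormalForm

/-- If the link of `(α, τ)` projects onto a subspace of codimension one, then there is a conormal
form. -/
theorem exists_isConormalForm [Module.Finite ℤ N] (hΔ : Δ.IsComplete) {τ : Finset N} {α : N}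
    (hα : α ∈ Δ.linkRays τ)
    (h : IsCodimOneSubspace (Δ.linkSupportIn τ (insert α τ))) :
    ∃ m, Δ.IsConormalForm τ α m := by
  obtain ⟨H, hH, hfr⟩ := h
  have hcov : ∀ x : QuotSpace τ, ∃ y ∈ H, ∃ c : ℝ, x = y + c • (realSpan τ).mkQ (toReal α) := by
    intro x
    obtain ⟨x, rfl⟩ := (realSpan τ).mkQ_surjective x
    obtain ⟨t, ht, y, hy, hxy⟩ := hΔ.exists_mem_link (insert_mem_cones hα) x
    rw [realSpan, Finset.coe_insert, Set.image_insert_eq, Submodule.mem_span_insert] at hxy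
    obtain ⟨c, z, hz, hc⟩ := hxy
    have hyH : (realSpan τ).mkQ y ∈ H := by
      have : (realSpan τ).mkQ y ∈ (H : Set _) := by
        rw [hH]
        exact ⟨y, Set.mem_biUnion ht hy, rfl⟩
      exact this
    refine ⟨_, hyH, c, ?_⟩
    have hz0 : (realSpan τ).mkQ z = 0 := (Submodule.Quotient.mk_eq_zero _).2 hz
    have := congrArg (realSpan τ).mkQ hc
    rw [map_sub, map_add, map_smul, hz0, add_zero, sub_eq_iff_eq_add] at this
    rw [this, add_comm]
  -- `H` and the image of `α` span everything, so `α` in `H` would make the codimension `0`.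
  have hαH : (realSpan τ).mkQ (toReal α) ∉ H := by
    intro hmem
    have htop : H = ⊤ := by
      refine eq_top_iff.2 fun x _ => ?_
      obtain ⟨y, hy, c, rfl⟩ := hcov x
      exact H.add_mem hy (H.smul_mem c hmem)
    subst htop
    rw [Module.finrank_zero_of_subsingleton] at hfr
    exact zero_ne_one hfr
  obtain ⟨f, hf, hfH⟩ := Submodule.exists_le_ker_of_notMem hαH
  refine ⟨(f ((realSpan τ).mkQ (toReal α)))⁻¹ • f.comp (realSpan τ).mkQ, ?_, ?_, ?_⟩
  · simp only [LinearMap.smul_apply, LinearMap.comp_apply, smul_eq_mul]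
    exact inv_mul_cancel₀ hf
  · intro v hv
    have : (realSpan τ).mkQ (toReal v) = 0 :=
      (Submodule.Quotient.mk_eq_zero _).2 (toReal_mem_realSpan hv)
    rw [LinearMap.smul_apply, LinearMap.comp_apply, this, map_zero, smul_zero]
  · intro w hw
    have hwH : (realSpan τ).mkQ (toReal w) ∈ (H : Set _) := by
      rw [hH]
      exact ⟨_, Set.mem_biUnion hw (toReal_mem_cone (Finset.mem_singleton_self w)), rfl⟩
    rw [LinearMap.smul_apply, LinearMap.comp_apply, LinearMap.mem_ker.1 (hfH hwH), smul_zero]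

/-- The form descends to a surjective functional on `N(τ)_ℝ`, and its kernel is the projected link.
-/
theorem IsConormalForm.isCodimOneSubspace {τ : Finset N} {α : N} {m : RealSpace N →ₗ[ℝ] ℝ}
    (h : Δ.IsConormalForm τ α m) (hΔ : Δ.IsComplete) (hα : α ∈ Δ.linkRays τ) :
    IsCodimOneSubspace (Δ.linkSupportIn τ (insert α τ)) := by
  let f : QuotSpace τ →ₗ[ℝ] ℝ := (realSpan τ).liftQ m fun x hx => h.apply_realSpan hx
  have hf : Function.Surjective f := fun r => ⟨(realSpan τ).mkQ (r • toReal α), by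
    change m (r • toReal α) = r
    rw [map_smul, h.apply_self, smul_eq_mul, mul_one]⟩
  refine ⟨LinearMap.ker f, ?_, ?_⟩
  · rw [h.linkSupportIn_eq hΔ hα]
    ext x
    obtain ⟨x, rfl⟩ := (realSpan τ).mkQ_surjective x
    constructor
    · intro hx
      exact ⟨x, hx, rfl⟩
    · rintro ⟨y, hy, hxy⟩
      rw [← hxy]
      exact hy
  · rw [(f.quotKerEquivOfSurjective hf).finrank_eq, Module.finrank_self]

/-! ### Recovering links from their supports -/

/-- The support of a link determines the link. -/
theorem link_subset_of_linkSupport_subset {s s' : Finset N}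
    (h : Δ.linkSupport s ⊆ Δ.linkSupport s') : Δ.link s ⊆ Δ.link s' := by
  intro t ht
  have hp : ∑ u ∈ t, toReal u ∈ Δ.linkSupport s' := h (Set.mem_biUnion ht (sum_mem_cone t))
  simp only [linkSupport, Set.mem_iUnion] at hp
  obtain ⟨t', ht', hp⟩ := hp
  exact link_mono ht' (subset_of_sum_mem_cone (mem_cones_of_mem_link ht)
    (mem_cones_of_mem_link ht') hp)

/-- Both links lie in the link of `τ`, whose support projects injectively, so the inclusion lifts to
`N_ℝ`. -/
theorem linkSupport_subset_of_linkSupportIn_subset {τ : Finset N} {α β : N}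
    (h : Δ.linkSupportIn τ (insert α τ) ⊆ Δ.linkSupportIn τ (insert β τ)) :
    Δ.linkSupport (insert α τ) ⊆ Δ.linkSupport (insert β τ) := by
  intro x hx
  obtain ⟨y, hy, hxy⟩ := h ⟨x, hx, rfl⟩
  have hy₀ := hy
  simp only [linkSupport, Set.mem_iUnion] at hx hy₀
  obtain ⟨t, ht, hx⟩ := hx
  obtain ⟨t', ht', hy'⟩ := hy₀
  rwa [← eq_of_sub_mem_realSpan (mem_link_of_mem_link_insert ht')
    (mem_link_of_mem_link_insert ht) hy' hx ((Submodule.Quotient.eq _).1 hxy)]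

/-- A cone of the link of `τ` on the positive side of a conormal form contains `α`, unless it lies
in the link of `(α, τ)`. -/
theorem IsConormalForm.mem_of_nonneg {τ : Finset N} {α : N} {m : RealSpace N →ₗ[ℝ] ℝ}
    (h : Δ.IsConormalForm τ α m) (hΔ : Δ.IsComplete) (hα : α ∈ Δ.linkRays τ) {t : Finset N}
    (ht : t ∈ Δ.link τ) (hm : 0 ≤ m (∑ u ∈ t, toReal u)) :
    t ∈ Δ.link (insert α τ) ∪ insert α '' Δ.link (insert α τ) := by
  obtain ⟨t', ht', y, hy, hxy⟩ := h.exists_mem_link hΔ hα (∑ u ∈ t, toReal u)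
  -- Nonnegativity of `m` puts the decomposition in a cone of the link of `τ`; by injectivity it is
  -- the interior point of `cone t` itself.
  have hz : y + m (∑ u ∈ t, toReal u) • toReal α ∈ cone (insert α t') :=
    Submodule.add_mem _ (cone_mono (Finset.subset_insert _ _) hy)
      (smul_mem_cone (toReal_mem_cone (Finset.mem_insert_self _ _)) hm)
  have hl := insert_mem_link hα ht'
  have heq := eq_of_sub_mem_realSpan ht hl (sum_mem_cone t) hz hxy
  have hsub : t ⊆ insert α t' := subset_of_sum_mem_cone (mem_cones_of_mem_link ht)
    (mem_cones_of_mem_link hl) (heq ▸ hz)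
  by_cases hαt : α ∈ t
  · exact Or.inr ⟨t.erase α, link_mono ht' (Finset.subset_insert_iff.1 hsub),
      Finset.insert_erase hαt⟩
  · exact Or.inl (link_mono ht' ((Finset.subset_insert_iff_of_notMem hαt).1 hsub))

end SimplicialFan

end Toric

/-! ### Adjacency, uniqueness of the opposite ray, and the suspension -/

theorem mainTheorem4 {N : Type*} [AddCommGroup N] [Module.Free ℤ N] [Module.Finite ℤ N]
    [DecidableEq N] (Δ : Toric.SimplicialFan N)
    (hcomplete : Δ.IsComplete) (hconvex : Δ.IsLocallyConvex)
    (σ : Finset N) (hσ : σ ∈ Δ.cones) (ρ : N) (hρ : ρ ∈ σ)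
    (hvanish : Δ.conormal σ ρ = 0)
    (τ : Finset N) (hτ : τ = σ.erase ρ) :
    (∀ α ∈ Δ.linkRays τ,
      (Δ.conormal (insert α τ) α = 0 ↔
        Toric.IsCodimOneSubspace (Δ.linkSupportIn τ (insert α τ)))) ∧
    (∀ β ∈ Δ.linkRays τ, (β ∈ Δ.linkRays {ρ} ↔ β ∈ Δ.linkRays σ)) ∧
    {β | β ∈ Δ.linkRays τ ∧ β ≠ ρ ∧ β ∉ Δ.linkRays {ρ} ∧
      Δ.conormal (insert β τ) β = 0}.Subsingleton ∧
    (∀ β ∈ Δ.linkRays τ, β ≠ ρ → β ∉ Δ.linkRays {ρ} → Δ.conormal (insert β τ) β = 0 →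
      Δ.linkSupportIn τ (insert β τ) = Δ.linkSupportIn τ σ ∧
      Δ.linkSupport (insert β τ) = Δ.linkSupport σ ∧
      Δ.link τ = Δ.link σ ∪ insert ρ '' Δ.link σ ∪ insert β '' Δ.link σ) := by
  have hστ : insert ρ τ = σ := by rw [hτ, Finset.insert_erase hρ]
  have hρτ : ρ ∈ Δ.linkRays τ := by
    refine ⟨Finset.disjoint_singleton_right.2 (hτ ▸ Finset.notMem_erase ρ σ), ?_⟩
    rwa [Finset.union_comm, ← Finset.insert_eq, hστ]
  rw [← hστ, Toric.SimplicialFan.conormal_eq_zero_iff hρτ] at hvanish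
  obtain ⟨m, hm⟩ := hvanish
  rw [← hστ]
  have hadj : ∀ β ∈ Δ.linkRays τ, (β ∈ Δ.linkRays {ρ} ↔ β ∈ Δ.linkRays (insert ρ τ)) := by
    intro β hβ
    constructor
    · intro hβρ
      have hβρ' : β ≠ ρ := fun h =>
        Toric.SimplicialFan.notMem_of_mem_linkRays hβρ (h ▸ Finset.mem_singleton_self ρ)
      refine ⟨?_, ?_⟩
      · rw [Finset.disjoint_singleton_right, Finset.mem_insert]
        exact not_or.2 ⟨hβρ', Toric.SimplicialFan.notMem_of_mem_linkRays hβ⟩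
      · rw [Finset.insert_union]
        refine hconvex.insert_mem_cones
          (Δ.face_mem σ hσ _ (Finset.singleton_subset_iff.2 hρ)) hβ.2 fun u hu => ?_
        rcases Finset.mem_union.1 hu with hu | hu
        · refine Δ.face_mem σ hσ _ ?_
          rw [← hστ]
          exact Finset.insert_subset_insert _ (Finset.singleton_subset_iff.2 hu)
        · rw [Finset.mem_singleton.1 hu]
          exact hβρ.2
    · intro h
      refine ⟨h.1.mono_left (Finset.singleton_subset_iff.2 (Finset.mem_insert_self _ _)),
        Δ.face_mem _ h.2 _ (Finset.union_subset_union_left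
          (Finset.singleton_subset_iff.2 (Finset.mem_insert_self _ _)))⟩
  have hopp : ∀ β ∈ Δ.linkRays τ, β ≠ ρ → β ∉ Δ.linkRays {ρ} → Δ.conormal (insert β τ) β = 0 →
      ∃ m', Δ.IsConormalForm τ β m' ∧ ∃ c : ℝ, c < 0 ∧ ∀ x, m' x = c * m x := by
    intro β hβ hne hβρ hvan
    obtain ⟨m', hm'⟩ := (Toric.SimplicialFan.conormal_eq_zero_iff hβ).1 hvan
    refine ⟨m', hm', hm.exists_eq_smul hm' hcomplete hρτ hβ hne.symm fun h => ?_⟩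
    refine hβρ ⟨Finset.disjoint_singleton.2 hne.symm, ?_⟩
    refine Δ.face_mem _ h.2 _ (Finset.union_subset
      (Finset.singleton_subset_iff.2 ?_) (Finset.singleton_subset_iff.2 ?_))
    · exact Finset.mem_union_right _ (Finset.mem_singleton_self ρ)
    · exact Finset.mem_union_left _ (Finset.mem_insert_self _ _)
  refine ⟨fun α hα => ?_, hadj, ?_, ?_⟩
  · rw [Toric.SimplicialFan.conormal_eq_zero_iff hα]
    exact ⟨fun ⟨_, h⟩ => h.isCodimOneSubspace hcomplete hα,
      Toric.SimplicialFan.exists_isConormalForm hcomplete hα⟩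
  · rintro β ⟨hβ, hne, hβρ, hvan⟩ β' ⟨hβ', hne', hβρ', hvan'⟩
    obtain ⟨m₁, hm₁, c₁, hc₁, h₁⟩ := hopp β hβ hne hβρ hvan
    obtain ⟨m₂, hm₂, c₂, hc₂, h₂⟩ := hopp β' hβ' hne' hβρ' hvan'
    by_contra hββ'
    have hneg : m (Toric.toReal β) < 0 := by
      have := hm₁.apply_self
      rw [h₁] at this
      by_contra! h
      nlinarith
    have hpos : 0 < m₂ (Toric.toReal β) := by
      rw [h₂]
      exact mul_pos_of_neg_of_neg hc₂ hneg
    -- Both forms are positive at `β`, so `β` and `β'` are adjacent. Then `m₂` must vanish at `β`, a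
    -- contradiction.
    have hlink := hm₁.mem_linkRays_of_pos hm₂ hcomplete hβ hβ' hββ'
      (by rw [hm₁.apply_self]; exact one_pos) hpos
    exact hpos.ne' (hm₂.apply_linkRays _ hlink)
  · intro β hβ hne hβρ hvan
    obtain ⟨m', hm', c, hc, hmm⟩ := hopp β hβ hne hβρ hvan
    have hker : LinearMap.ker m' = LinearMap.ker m := by
      ext x
      rw [LinearMap.mem_ker, LinearMap.mem_ker, hmm, mul_eq_zero, or_iff_right hc.ne]
    have hIn : Δ.linkSupportIn τ (insert β τ) = Δ.linkSupportIn τ (insert ρ τ) := by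
      rw [hm'.linkSupportIn_eq hcomplete hβ, hm.linkSupportIn_eq hcomplete hρτ, hker]
    have hsupp : Δ.linkSupport (insert β τ) = Δ.linkSupport (insert ρ τ) :=
      (Toric.SimplicialFan.linkSupport_subset_of_linkSupportIn_subset hIn.subset).antisymm
        (Toric.SimplicialFan.linkSupport_subset_of_linkSupportIn_subset hIn.superset)
    have hlink : Δ.link (insert β τ) = Δ.link (insert ρ τ) :=
      (Toric.SimplicialFan.link_subset_of_linkSupport_subset hsupp.subset).antisymm
        (Toric.SimplicialFan.link_subset_of_linkSupport_subset hsupp.superset)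
    refine ⟨hIn, hsupp, Set.Subset.antisymm (fun t ht => ?_) ?_⟩
    · rcases le_total 0 (m (∑ u ∈ t, Toric.toReal u)) with h0 | h0
      · exact Or.inl (hm.mem_of_nonneg hcomplete hρτ ht h0)
      · have h1 := hm'.mem_of_nonneg hcomplete hβ ht (by
          rw [hmm]
          exact mul_nonneg_of_nonpos_of_nonpos hc.le h0)
        rw [hlink] at h1
        exact h1.elim (fun h => Or.inl (Or.inl h)) Or.inr
    · rintro t ((ht | ⟨t, ht, rfl⟩) | ⟨t, ht, rfl⟩)
      · exact Toric.SimplicialFan.mem_link_of_mem_link_insert ht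
      · exact Toric.SimplicialFan.insert_mem_link hρτ ht
      · exact Toric.SimplicialFan.insert_mem_link hβ (hlink ▸ ht)
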